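/- **Setting.** Let $\mathbb{Y}$ be a finite non-empty set of labels and let $D$ be a probability distribution on $\mathbb{R}^d\times\mathbb{Y}$ with joint density $g_c(x)=p(x,\mathbf{y}=c)$. Assume that every $g_c$ is twice continuously differentiable with integrable second derivative, $\int\|D^2 g_c(x)\|\,dx<\infty$, and that the marginal density $p(x)=\sum_c g_c(x)$ satisfies $\int\sqrt{p(x)}\,dx<\infty$ (for example, $p$ has compact support). Let $K:\mathbb{R}^d\to[0,\infty)$ be measurable, bounded and even, with $\int K(u)\,du=1$ and $\int\|u\|^2K(u)\,du<\infty$, and for a bandwidth $\sigma>0$ put $s_\sigma(x,x')=\sigma^{-d}K((x-x')/\sigma)$. For an i.i.d. sample $(x_1,y_1),\dots,(x_n,y_n)\sim D$ let $$\hat p_D(\mathbf{y}=c\mid \mathbf{x}=x_i)=\frac{\sum_{j\ne i}[y_j=c]\,s_\sigma(x_j,x_i)}{\sum_{k\neq i}s_\sigma(x_k,x_i)}\quad(\text{with } 0/0=0),\qquad \hat\beta_D=1-\frac1n\sum_{i=1}^n\max_{c}\hat p_D(\mathbf{y}=c\mid\mathbf{x}=x_i),$$ and let $\beta_D=\operatorname{E}_{\mathbf{x}}[1-\max_c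 p(\mathbf{y}=c\mid\mathbf{x})]$ be the Bayes error of $D$. **Theorem.** There are constants $C_1,C_2>0$, depending only on $D$ and $K$, such that for all $n\ge1$ and all $\sigma>0$, $$\operatorname{E}\bigl|\hat p_D(\mathbf{y}=c\mid\mathbf{x}=x_i)-p(\mathbf{y}=c\mid\mathbf{x}=x_i)\bigr|\le C_2\sigma^2+\frac{C_1}{\sqrt{n\sigma^d}}\qquad\text{for every } i\in\{1,\dots,n\},\ c\in\mathbb{Y},$$ and $$\operatorname{E}\bigl|\hat\beta_D-\beta_D\bigr|\le 2C_2|\mathbb{Y}|\sigma^2+\frac{2C_1|\mathbb{Y}|}{\sqrt{n\sigma^d}},$$ where the expectations are over the sample. -/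

import Mathlib

open MeasureTheory

noncomputable section

namespace BayesError

/-- Output of local posterior averaging on the sample `z = ((x₁,y₁),…,(xₙ,yₙ))` with similarity `s`:
the leave-one-out estimate of the posterior probability of the class `c` at the sample point `xᵢ`,
`(∑_{j ≠ i} [yⱼ = c] s(xⱼ,xᵢ)) / (∑_{k ≠ i} s(xₖ,xᵢ))`, with the convention `0 / 0 = 0`. -/
def posteriorEstimate {X Y : Type*} [DecidableEq Y] (s : X → X → ℝ) {n : ℕ}
    (z : Fin n → X × Y) (i : Fin n) (c : Y) : ℝ :=
  (∑ j ∈ Finset.univ.erase i, (if (z j).2 = c then 1 else 0) * s (z j).1 (z i).1) /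
    ∑ k ∈ Finset.univ.erase i, s (z k).1 (z i).1

/-- The plug-in Bayes error estimate `1 - (1/n) ∑ᵢ max_c p̂(c | xᵢ)`. -/
def bayesErrorEstimate {X Y : Type*} [DecidableEq Y] (s : X → X → ℝ) {n : ℕ}
    (z : Fin n → X × Y) : ℝ :=
  1 - (1 / (n : ℝ)) * ∑ i, ⨆ c, posteriorEstimate s z i c

/-- The true posterior probability `p(y = c | x)`: the regular conditional probability of the
label given the feature. -/
def posterior {X Y : Type*} [MeasurableSpace X] [MeasurableSpace Y] [StandardBorelSpace Y]
    [Nonempty Y] (D : Measure (X × Y)) [IsFiniteMeasure D] (x : X) (c : Y) : ℝ :=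
  (D.condKernel x).real {c}

/-- The Bayes error `E_x [1 - max_c p(y = c | x)]`, with `x` distributed as the first marginal
of `D`. -/
def bayesError {X Y : Type*} [MeasurableSpace X] [MeasurableSpace Y] [StandardBorelSpace Y]
    [Nonempty Y] (D : Measure (X × Y)) [IsFiniteMeasure D] : ℝ :=
  ∫ x, (1 - ⨆ c, posterior D x c) ∂D.fst

/-- A smoothing kernel on `ℝᵈ`: nonnegative, even, bounded, of integral one (hence integrable), with
finite second moment. -/
structure IsSmoothingKernel {d : ℕ} (K : EuclideanSpace ℝ (Fin d) → ℝ) : Prop where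
  measurable : Measurable K
  nonneg : ∀ u, 0 ≤ K u
  even : ∀ u, K (-u) = K u
  bounded : ∃ κ : ℝ, ∀ u, K u ≤ κ
  integral_eq_one : ∫ u, K u = 1
  second_moment : Integrable (fun u => ‖u‖ ^ 2 * K u)

/-- The similarity function `s(x, x') = σ⁻ᵈ K((x - x') / σ)` of bandwidth `σ`. -/
def similarity {d : ℕ} (K : EuclideanSpace ℝ (Fin d) → ℝ) (σ : ℝ)
    (x x' : EuclideanSpace ℝ (Fin d)) : ℝ :=
  (σ ^ d)⁻¹ * K (σ⁻¹ • (x - x'))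

/-- `g c` is the joint density `p(x, y = c)` (Lebesgue in `x`, counting in `c`) of `D`, and it has
the regularity of the second order analysis of kernel regression: it is twice continuously
differentiable with integrable second derivative, and the square root of the marginal
density `∑ c, g c` is integrable. -/
structure IsRegularDensity {d : ℕ} {Y : Type*} [Fintype Y] [MeasurableSpace Y]
    (D : Measure (EuclideanSpace ℝ (Fin d) × Y)) (g : Y → EuclideanSpace ℝ (Fin d) → ℝ) :
    Prop where
  nonneg : ∀ c x, 0 ≤ g c x
  density : ∀ c (A : Set (EuclideanSpace ℝ (Fin d))), MeasurableSet A →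
    D (A ×ˢ {c}) = ∫⁻ x in A, ENNReal.ofReal (g c x)
  contDiff : ∀ c, ContDiff ℝ 2 (g c)
  integrable_hessian : ∀ c, Integrable (iteratedFDeriv ℝ 2 (g c))
  integrable_sqrt : Integrable (fun x => √(∑ c, g c x))

end BayesError

end

noncomputable section

namespace BayesError

/-! Conditioning on `xᵢ = x` turns the error at `xᵢ` into `∫ p(x) E|N/S - q| dx`, where `N/S` is the
kernel ratio built from the other `m = n - 1` points, `q` is the posterior and `p` the marginal
density. The weight `p` is what saves the ratio: `p (N/S - q) = (N/m - g) - (N/S)(S/m - p)` with `0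
≤ N/S ≤ 1`, so no lower bound on `p` is needed (`mul_abs_div_sub_le`).

Each of the two deviations splits into bias and fluctuation. Evenness of `K` writes the bias as an
average of second differences of the density, whose `L¹` norm is controlled by the Hessian, whence
`σ²` (`lintegral_bias_le`). As `K` is bounded, the fluctuation is of order `√((p + B) / (m σᵈ))`,
where `B` is the total bias. Where `B ≤ p` this is a multiple of `√p`, which is integrable; where `p
≤ B` the error is at most 1 and the weight `p` is already bounded by the bias
(`marginal_mul_integral_kernelEstimate_le`).

For the Bayes error, the maximum is Lipschitz in the posteriors, and averaging the true maxima over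
the sample costs only `1/√n`, which the same rate absorbs once both constants are at least 1
(`one_div_sqrt_le_rate`). -/

/-! ### Second differences in `L¹` -/

theorem abs_second_difference_le_integral {f f' f'' : ℝ → ℝ} (hf : ∀ t, HasDerivAt f (f' t) t)
    (hf' : ∀ t, HasDerivAt f' (f'' t) t) (hc : Continuous f'') :
    |f 1 + f (-1) - 2 * f 0| ≤ ∫ t in (-1 : ℝ)..1, |f'' t| := by
  have hφ : ∀ t, HasDerivAt (fun t => f t + f (-t)) (f' t - f' (-t)) t := fun t => by
    exact ((hf t).add ((hf (-t)).scomp t (hasDerivAt_neg t))).congr_deriv (by simp; ring)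
  -- The mean value theorem for the symmetrized function `f t + f (-t)` on `[0, 1]` reduces the
  -- second difference to one increment of `f'` over `[-t, t]`.
  obtain ⟨t, ⟨ht0, ht1⟩, ht⟩ := exists_hasDerivAt_eq_slope _ _ (zero_lt_one' ℝ)
    (fun t _ => (hφ t).continuousAt.continuousWithinAt) (fun t _ => hφ t)
  have hval : f 1 + f (-1) - 2 * f 0 = f' t - f' (-t) := by
    rw [ht]; simp; ring
  have hint : ∫ r in (-t)..t, f'' r = f' t - f' (-t) :=
    intervalIntegral.integral_eq_sub_of_hasDerivAt (fun r _ => hf' r) (hc.intervalIntegrable _ _)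
  rw [hval, ← hint]
  calc |∫ r in (-t)..t, f'' r| ≤ ∫ r in (-t)..t, |f'' r| :=
        intervalIntegral.abs_integral_le_integral_abs (by linarith)
    _ ≤ ∫ r in (-1 : ℝ)..1, |f'' r| :=
        intervalIntegral.integral_mono_interval (by linarith) (by linarith) ht1.le
          (Filter.Eventually.of_forall fun _ => abs_nonneg _)
          (hc.abs.intervalIntegrable _ _)

section SecondDifference

variable {E : Type*} [NormedAddCommGroup E] [NormedSpace ℝ E]

theorem abs_second_difference_le {g : E → ℝ} (hg : ContDiff ℝ 2 g) (x v : E) :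
    |g (x + v) + g (x - v) - 2 * g x| ≤
      ∫ t in (-1 : ℝ)..1, ‖iteratedFDeriv ℝ 2 g (x + t • v)‖ * ‖v‖ ^ 2 := by
  have hline : ∀ t : ℝ, HasDerivAt (fun t : ℝ => x + t • v) v t := fun t => by
    simpa using ((hasDerivAt_id t).smul_const v).const_add x
  have hg1 : ContDiff ℝ 1 (fderiv ℝ g) := hg.fderiv_right (by norm_num)
  have hd1 : ∀ t : ℝ, HasDerivAt (fun t : ℝ => g (x + t • v)) (fderiv ℝ g (x + t • v) v) t :=
    fun t => ((hg.differentiable (by norm_num)) _).hasFDerivAt.comp_hasDerivAt t (hline t)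
  have hd2 : ∀ t : ℝ, HasDerivAt (fun t : ℝ => fderiv ℝ g (x + t • v) v)
      (fderiv ℝ (fderiv ℝ g) (x + t • v) v v) t := fun t => by
    have := ((hg1.differentiable (by norm_num)) _).hasFDerivAt.comp_hasDerivAt t (hline t)
    simpa using this.clm_apply (hasDerivAt_const t v)
  have hcont : Continuous fun t : ℝ => fderiv ℝ (fderiv ℝ g) (x + t • v) v v := by
    have := (hg1.continuous_fderiv (by norm_num))
    fun_prop
  have hcont' : Continuous fun t : ℝ => ‖iteratedFDeriv ℝ 2 g (x + t • v)‖ * ‖v‖ ^ 2 := by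
    have := hg.continuous_iteratedFDeriv (m := 2) le_rfl
    fun_prop
  have key := abs_second_difference_le_integral hd1 hd2 hcont
  simp only [one_smul, neg_smul, zero_smul, add_zero, ← sub_eq_add_neg] at key
  refine key.trans (intervalIntegral.integral_mono_on (by norm_num)
    (hcont.abs.intervalIntegrable _ _) (hcont'.intervalIntegrable _ _) fun t _ => ?_)
  have h := (iteratedFDeriv ℝ 2 g (x + t • v)).le_opNorm ![v, v]
  simpa [iteratedFDeriv_two_apply, pow_two] using h

variable [MeasurableSpace E] [BorelSpace E] [FiniteDimensional ℝ E]

/-- The pointwise bound integrates the Hessian along a segment; after Tonelli, translation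
invariance makes every `t` contribute the same, and 2 is the length of `[-1, 1]`. -/
theorem lintegral_second_difference_le {g : E → ℝ} (hg : ContDiff ℝ 2 g) (μ : Measure E)
    [μ.IsAddHaarMeasure] (v : E) :
    ∫⁻ x, ENNReal.ofReal |g (x + v) + g (x - v) - 2 * g x| ∂μ ≤
      2 * ENNReal.ofReal (‖v‖ ^ 2) * ∫⁻ x, ‖iteratedFDeriv ℝ 2 g x‖ₑ ∂μ := by
  have hc := hg.continuous_iteratedFDeriv (m := 2) le_rfl
  have hm : Measurable fun y : E => ‖iteratedFDeriv ℝ 2 g y‖ₑ := hc.enorm.measurable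
  have hpt : ∀ x, ENNReal.ofReal |g (x + v) + g (x - v) - 2 * g x| ≤
      ∫⁻ t in Set.Ioc (-1 : ℝ) 1,
        ‖iteratedFDeriv ℝ 2 g (x + t • v)‖ₑ * ENNReal.ofReal (‖v‖ ^ 2) := fun x => by
    refine (ENNReal.ofReal_le_ofReal (abs_second_difference_le hg x v)).trans_eq ?_
    have hcont' : Continuous fun t : ℝ => ‖iteratedFDeriv ℝ 2 g (x + t • v)‖ * ‖v‖ ^ 2 := by
      fun_prop
    rw [intervalIntegral.integral_of_le (by norm_num), ofReal_integral_eq_lintegral_ofReal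
      ((intervalIntegrable_iff_integrableOn_Ioc_of_le (by norm_num)).1
        (hcont'.intervalIntegrable _ _)) (Filter.Eventually.of_forall fun _ => by positivity)]
    simp_rw [ENNReal.ofReal_mul (norm_nonneg _), ofReal_norm]
  refine (lintegral_mono hpt).trans_eq ?_
  have hjoint : Measurable fun q : E × ℝ =>
      ‖iteratedFDeriv ℝ 2 g (q.1 + q.2 • v)‖ₑ * ENNReal.ofReal (‖v‖ ^ 2) :=
    (hm.comp (by fun_prop)).mul_const _
  rw [lintegral_lintegral_swap hjoint.aemeasurable]
  have hinner : ∀ t : ℝ, ∫⁻ x, ‖iteratedFDeriv ℝ 2 g (x + t • v)‖ₑ * ENNReal.ofReal (‖v‖ ^ 2) ∂μ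
      = (∫⁻ x, ‖iteratedFDeriv ℝ 2 g x‖ₑ ∂μ) * ENNReal.ofReal (‖v‖ ^ 2) := fun t => by
    rw [lintegral_mul_const' _ _ ENNReal.ofReal_ne_top,
      lintegral_add_right_eq_self (fun x => ‖iteratedFDeriv ℝ 2 g x‖ₑ)]
  simp_rw [hinner, setLIntegral_const, Real.volume_Ioc]
  norm_num
  ring

end SecondDifference

/-! ### Smoothing bias of a kernel -/

namespace IsSmoothingKernel

variable {d : ℕ} {K : EuclideanSpace ℝ (Fin d) → ℝ}

theorem integrable (hK : IsSmoothingKernel K) : Integrable K :=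
  Integrable.of_integral_ne_zero (by rw [hK.integral_eq_one]; exact one_ne_zero)

theorem integral_similarity_mul (σ : ℝ) (hσ : 0 < σ) (g : EuclideanSpace ℝ (Fin d) → ℝ)
    (x : EuclideanSpace ℝ (Fin d)) :
    ∫ x', similarity K σ x' x * g x' = ∫ u, K u * g (x + σ • u) := by
  have h1 := integral_add_left_eq_self (μ := volume) (fun x' => similarity K σ x' x * g x') x
  have h2 := Measure.integral_comp_smul (volume : Measure (EuclideanSpace ℝ (Fin d)))
    (fun x' => similarity K σ (x + x') x * g (x + x')) σ
  rw [← h1]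
  simp only [similarity, add_sub_cancel_left, smul_smul, inv_mul_cancel₀ hσ.ne', one_smul,
    finrank_euclideanSpace, Fintype.card_fin, abs_inv, abs_pow, abs_of_pos hσ, smul_eq_mul,
    mul_assoc, integral_const_mul] at h2 ⊢
  exact (mul_left_cancel₀ (inv_ne_zero (pow_pos hσ d).ne') h2).symm

theorem integrable_mul_comp_add_smul (hK : IsSmoothingKernel K) {σ : ℝ} (hσ : σ ≠ 0)
    {g : EuclideanSpace ℝ (Fin d) → ℝ} (hg : Integrable g) (x : EuclideanSpace ℝ (Fin d)) :
    Integrable fun u => K u * g (x + σ • u) := by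
  obtain ⟨κ, hκ⟩ := hK.bounded
  refine ((hg.comp_add_left x).comp_smul hσ).bdd_mul (c := κ) hK.measurable.aestronglyMeasurable
    (Filter.Eventually.of_forall fun u => ?_)
  rw [Real.norm_of_nonneg (hK.nonneg u)]; exact hκ u

/-- Evenness of `K` allows averaging over `u` and `-u`, which removes the first-order term of the
expansion and leaves order `σ²`. -/
theorem bias_eq (hK : IsSmoothingKernel K) {σ : ℝ} (hσ : 0 < σ)
    {g : EuclideanSpace ℝ (Fin d) → ℝ} (hg : Integrable g) (x : EuclideanSpace ℝ (Fin d)) :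
    (∫ x', similarity K σ x' x * g x') - g x =
      2⁻¹ * ∫ u, K u * (g (x + σ • u) + g (x - σ • u) - 2 * g x) := by
  have h1 := hK.integrable_mul_comp_add_smul hσ.ne' hg x
  have h2 : Integrable fun u => K u * g (x - σ • u) := by
    simpa [hK.even, sub_eq_add_neg] using h1.comp_neg
  have h3 : ∫ u, K u * g (x - σ • u) = ∫ u, K u * g (x + σ • u) := by
    rw [← integral_neg_eq_self (fun u => K u * g (x + σ • u))]
    simp [hK.even, sub_eq_add_neg]
  have h4 : Integrable fun u => K u * (2 * g x) := hK.integrable.mul_const _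
  have h5 : ∫ u, K u * (2 * g x) = 2 * g x := by
    rw [integral_mul_const, hK.integral_eq_one, one_mul]
  simp_rw [mul_sub, mul_add]
  rw [integral_sub (f := fun u => K u * g (x + σ • u) + K u * g (x - σ • u)) (h1.add h2) h4, integral_add h1 h2, h3, h5, integral_similarity_mul σ hσ]
  ring

theorem measurable_similarity (hK : IsSmoothingKernel K) (σ : ℝ) :
    Measurable fun q : EuclideanSpace ℝ (Fin d) × EuclideanSpace ℝ (Fin d) =>
      similarity K σ q.1 q.2 :=
  (hK.measurable.comp (by fun_prop)).const_mul _

/-- Stated with the lower integral so that Tonelli applies before integrability of the bias is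
known; finiteness of the right side then supplies that integrability. -/
theorem lintegral_bias_le (hK : IsSmoothingKernel K) {σ : ℝ} (hσ : 0 < σ)
    {g : EuclideanSpace ℝ (Fin d) → ℝ} (hg : Integrable g) (hg2 : ContDiff ℝ 2 g)
    (hH : Integrable (iteratedFDeriv ℝ 2 g)) :
    ∫⁻ x, ENNReal.ofReal |(∫ x', similarity K σ x' x * g x') - g x| ≤
      ENNReal.ofReal (σ ^ 2 * (∫ u, ‖u‖ ^ 2 * K u) * ∫ x, ‖iteratedFDeriv ℝ 2 g x‖) := by
  have hgm := hg2.continuous.measurable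
  have hKm := hK.measurable
  calc ∫⁻ x, ENNReal.ofReal |(∫ x', similarity K σ x' x * g x') - g x|
    _ ≤ ∫⁻ x, ENNReal.ofReal 2⁻¹ * ∫⁻ u, ENNReal.ofReal (K u) *
          ENNReal.ofReal |g (x + σ • u) + g (x - σ • u) - 2 * g x| := by
        refine lintegral_mono fun x => ?_
        rw [hK.bias_eq hσ hg, abs_mul, abs_of_pos (by norm_num), ENNReal.ofReal_mul (by norm_num)]
        gcongr
        rw [← Real.norm_eq_abs, ofReal_norm]
        refine (enorm_integral_le_lintegral_enorm _).trans_eq (lintegral_congr fun u => ?_)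
        rw [← ofReal_norm, norm_mul, Real.norm_of_nonneg (hK.nonneg u), Real.norm_eq_abs,
          ENNReal.ofReal_mul (hK.nonneg u)]
    _ = ENNReal.ofReal 2⁻¹ * ∫⁻ u, ENNReal.ofReal (K u) *
          ∫⁻ x, ENNReal.ofReal |g (x + σ • u) + g (x - σ • u) - 2 * g x| := by
        rw [lintegral_const_mul' _ _ (by simp), lintegral_lintegral_swap]
        · congr 1
          refine lintegral_congr fun u => ?_
          rw [lintegral_const_mul' _ _ (by simp)]
        · refine Measurable.aemeasurable ?_
          dsimp only [Function.uncurry_def]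
          fun_prop
    _ ≤ ENNReal.ofReal 2⁻¹ * ∫⁻ u, ENNReal.ofReal (K u) * (2 * ENNReal.ofReal (‖σ • u‖ ^ 2) *
          ∫⁻ x, ‖iteratedFDeriv ℝ 2 g x‖ₑ) := by
        gcongr with u
        exact lintegral_second_difference_le hg2 volume (σ • u)
    _ = ENNReal.ofReal (σ ^ 2 * (∫ u, ‖u‖ ^ 2 * K u) * ∫ x, ‖iteratedFDeriv ℝ 2 g x‖) := by
        rw [ENNReal.ofReal_mul (mul_nonneg (sq_nonneg _)
          (integral_nonneg fun u => mul_nonneg (sq_nonneg _) (hK.nonneg u))),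
          ENNReal.ofReal_mul (sq_nonneg _), ofReal_integral_norm_eq_lintegral_enorm hH,
          ofReal_integral_eq_lintegral_ofReal hK.second_moment
            (Filter.Eventually.of_forall fun u => mul_nonneg (sq_nonneg _) (hK.nonneg u)),
          ← lintegral_const_mul' _ _ (ENNReal.ofReal_ne_top (r := σ ^ 2)),
          ← lintegral_mul_const' _ _ hH.2.ne,
          ← lintegral_const_mul' _ _ (ENNReal.ofReal_ne_top (r := 2⁻¹))]
        refine lintegral_congr fun u => ?_
        rw [norm_smul, mul_pow, Real.norm_eq_abs, sq_abs, ENNReal.ofReal_mul (sq_nonneg σ),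
          ENNReal.ofReal_mul (sq_nonneg ‖u‖), ENNReal.ofReal_inv_of_pos (by norm_num)]
        have h2 : (ENNReal.ofReal 2)⁻¹ * 2 = 1 := by
          rw [ENNReal.ofReal_ofNat]; exact ENNReal.inv_mul_cancel (by norm_num) (by norm_num)
        calc _ = ((ENNReal.ofReal 2)⁻¹ * 2) * (ENNReal.ofReal (σ ^ 2) * (ENNReal.ofReal (‖u‖ ^ 2) *
              ENNReal.ofReal (K u)) * ∫⁻ x, ‖iteratedFDeriv ℝ 2 g x‖ₑ) := by ring
          _ = _ := by rw [h2, one_mul]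

theorem integrable_bias_and_integral_le (hK : IsSmoothingKernel K) {σ : ℝ} (hσ : 0 < σ)
    {g : EuclideanSpace ℝ (Fin d) → ℝ} (hg : Integrable g) (hg2 : ContDiff ℝ 2 g)
    (hH : Integrable (iteratedFDeriv ℝ 2 g)) :
    Integrable (fun x => |(∫ x', similarity K σ x' x * g x') - g x|) ∧
      ∫ x, |(∫ x', similarity K σ x' x * g x') - g x| ≤
        σ ^ 2 * (∫ u, ‖u‖ ^ 2 * K u) * ∫ x, ‖iteratedFDeriv ℝ 2 g x‖ := by
  have hle := hK.lintegral_bias_le hσ hg hg2 hH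
  have hgm := hg2.continuous.measurable
  have hs := hK.measurable_similarity σ
  have hm : StronglyMeasurable fun x => |(∫ x', similarity K σ x' x * g x') - g x| := by
    have hjoint : StronglyMeasurable
        (Function.uncurry fun x x' : EuclideanSpace ℝ (Fin d) => similarity K σ x' x * g x') :=
      ((hs.comp measurable_swap).mul (hgm.comp measurable_snd)).stronglyMeasurable
    exact (hjoint.integral_prod_right.measurable.sub hgm).abs.stronglyMeasurable
  have h0 : 0 ≤ᵐ[volume] fun x => |(∫ x', similarity K σ x' x * g x') - g x| :=
    Filter.Eventually.of_forall fun _ => abs_nonneg _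
  refine ⟨⟨hm.aestronglyMeasurable, (hasFiniteIntegral_iff_ofReal h0).2
    (hle.trans_lt ENNReal.ofReal_lt_top)⟩, ?_⟩
  rw [integral_eq_lintegral_of_nonneg_ae h0 hm.aestronglyMeasurable]
  refine ENNReal.toReal_le_of_le_ofReal ?_ hle
  exact mul_nonneg (mul_nonneg (sq_nonneg _)
    (integral_nonneg fun u => mul_nonneg (sq_nonneg _) (hK.nonneg u)))
    (integral_nonneg fun _ => norm_nonneg _)

end IsSmoothingKernel

/-! ### Fluctuation of an empirical average -/

open ProbabilityTheory in
/-- The mean absolute deviation of the average of `m` independent copies of `f` is at most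
`√(E f² / m)`. -/
theorem integral_abs_average_sub_le {Z : Type*} [MeasurableSpace Z] (D : Measure Z)
    [IsProbabilityMeasure D] {f : Z → ℝ} (hf : MemLp f 2 D) {m : ℕ} (hm : 0 < m) :
    Integrable (fun w : Fin m → Z => |(∑ j, f (w j)) / m - ∫ z, f z ∂D|) (Measure.pi fun _ => D) ∧
    ∫ w : Fin m → Z, |(∑ j, f (w j)) / m - ∫ z, f z ∂D| ∂(Measure.pi fun _ => D) ≤
      √((∫ z, f z ^ 2 ∂D) / m) := by
  have hm' : (0 : ℝ) < m := by exact_mod_cast hm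
  set P : Measure (Fin m → Z) := Measure.pi fun _ => D
  have hcoord : ∀ j : Fin m, MemLp (fun w : Fin m → Z => f (w j)) 2 P := fun j =>
    hf.comp_measurePreserving (measurePreserving_eval (fun _ : Fin m => D) j)
  have hS : MemLp (∑ j, fun w : Fin m → Z => f (w j)) 2 P := memLp_finsetSum' _ fun j _ => hcoord j
  have hmean : ∫ w, (∑ j, fun w : Fin m → Z => f (w j)) w ∂P = m * ∫ z, f z ∂D := by
    simp only [Finset.sum_apply]
    rw [integral_finsetSum _ fun j _ => (hcoord j).integrable one_le_two]
    have : ∀ j : Fin m, ∫ w, f (w j) ∂P = ∫ z, f z ∂D := fun j =>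
      integral_comp_eval (μ := fun _ : Fin m => D) hf.aestronglyMeasurable
    simp [this]
  have hvar : Var[∑ j, fun w : Fin m → Z => f (w j); P] ≤ m * ∫ z, f z ^ 2 ∂D := by
    rw [variance_sum_pi (μ := fun _ : Fin m => D) (X := fun _ => f) fun _ => hf]
    simpa using mul_le_mul_of_nonneg_left (variance_le_expectation_sq hf.aestronglyMeasurable)
      hm'.le
  set T : (Fin m → Z) → ℝ := fun w => |(∑ j, f (w j)) / m - ∫ z, f z ∂D| with hT
  have hTL : MemLp T 2 P := by
    have h := ((hS.const_mul (m : ℝ)⁻¹).sub (memLp_const (∫ z, f z ∂D))).abs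
    refine h.ae_eq (Filter.Eventually.of_forall fun w => ?_)
    simp [hT, div_eq_inv_mul]
  have hTsq : ∫ w, T w ^ 2 ∂P ≤ (∫ z, f z ^ 2 ∂D) / m := by
    rw [variance_eq_integral hS.aemeasurable, hmean] at hvar
    have : ∀ w, T w ^ 2 = ((m : ℝ) ^ 2)⁻¹ *
        ((∑ j, fun w : Fin m → Z => f (w j)) w - m * ∫ z, f z ∂D) ^ 2 := fun w => by
      simp only [hT, sq_abs, Finset.sum_apply]
      field_simp
    simp_rw [this]
    rw [integral_const_mul]
    calc _ ≤ ((m : ℝ) ^ 2)⁻¹ * (m * ∫ z, f z ^ 2 ∂D) := by gcongr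
      _ = _ := by field_simp
  refine ⟨hTL.integrable one_le_two, Real.le_sqrt_of_sq_le (le_trans ?_ hTsq)⟩
  -- Nonnegativity of the variance of `T` is the inequality `(E T)² ≤ E T²`.
  have h0 := variance_nonneg T P
  rw [variance_eq_sub hTL] at h0
  simpa using h0

/-! ### The ratio estimate and the leave-one-out structure -/

section Estimate

variable {X Y : Type*} [DecidableEq Y]

/-- The kernel estimate of the posterior probability of the class `c` at the point `x`, from the
sample `w`. -/
def kernelEstimate (s : X → X → ℝ) {m : ℕ} (w : Fin m → X × Y) (x : X) (c : Y) : ℝ :=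
  (∑ j, (if (w j).2 = c then 1 else 0) * s (w j).1 x) / ∑ k, s (w k).1 x

theorem posteriorEstimate_eq_kernelEstimate (s : X → X → ℝ) {m : ℕ} (z : Fin (m + 1) → X × Y)
    (i : Fin (m + 1)) (c : Y) :
    posteriorEstimate s z i c = kernelEstimate s (fun j => z (i.succAbove j)) (z i).1 c := by
  simp only [posteriorEstimate, kernelEstimate, Finset.sum_erase_eq_sub (Finset.mem_univ i),
    Fin.sum_univ_succAbove _ i, add_sub_cancel_left]

theorem classWeight_nonneg {s : X → X → ℝ} (hs : ∀ x x', 0 ≤ s x x') (z : X × Y) (x : X) (c : Y) :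
    0 ≤ (if z.2 = c then 1 else 0) * s z.1 x :=
  mul_nonneg (by split_ifs <;> norm_num) (hs _ _)

theorem classWeight_le {s : X → X → ℝ} (hs : ∀ x x', 0 ≤ s x x') (z : X × Y) (x : X) (c : Y) :
    (if z.2 = c then 1 else 0) * s z.1 x ≤ s z.1 x :=
  mul_le_of_le_one_left (hs _ _) (by split_ifs <;> norm_num)

theorem kernelEstimate_nonneg {s : X → X → ℝ} (hs : ∀ x x', 0 ≤ s x x') {m : ℕ}
    (w : Fin m → X × Y) (x : X) (c : Y) : 0 ≤ kernelEstimate s w x c :=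
  div_nonneg (Finset.sum_nonneg fun _ _ => classWeight_nonneg hs _ _ _)
    (Finset.sum_nonneg fun _ _ => hs _ _)

theorem kernelEstimate_le_one {s : X → X → ℝ} (hs : ∀ x x', 0 ≤ s x x') {m : ℕ}
    (w : Fin m → X × Y) (x : X) (c : Y) : kernelEstimate s w x c ≤ 1 :=
  div_le_one_of_le₀ (Finset.sum_le_sum fun _ _ => classWeight_le hs _ _ _)
    (Finset.sum_nonneg fun _ _ => hs _ _)

/-- The deviation of a ratio `N / S ≤ 1` from `g / p` is controlled by the deviations of the
normalized numerator and denominator. -/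
theorem mul_abs_div_sub_le {N S p q g m : ℝ} (hN : 0 ≤ N) (hNS : N ≤ S) (hp : 0 ≤ p)
    (hg : p * q = g) : p * |N / S - q| ≤ |N / m - g| + |S / m - p| := by
  have hr0 : 0 ≤ N / S := div_nonneg hN (hN.trans hNS)
  have hr1 : N / S ≤ 1 := div_le_one_of_le₀ hNS (hN.trans hNS)
  -- This survives `S = 0`: then `0 ≤ N ≤ S` forces `N = 0`, so the convention `0 / 0 = 0` is
  -- harmless.
  have hr : N = N / S * S := by
    rcases eq_or_ne S 0 with h | h
    · rw [h] at hNS ⊢; linarith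
    · field_simp
  have : p * (N / S - q) = (N / m - g) - N / S * (S / m - p) := by
    have hr' : N / S * (S / m - p) = N / S * S / m - N / S * p := by ring
    rw [hr', ← hr, ← hg]; ring
  rw [← abs_of_nonneg hp, ← abs_mul, abs_of_nonneg hp, this]
  refine (abs_sub _ _).trans (add_le_add_right ?_ _)
  rw [abs_mul, abs_of_nonneg hr0]
  exact mul_le_of_le_one_left (abs_nonneg _) hr1

variable [MeasurableSpace X] [MeasurableSpace Y] [MeasurableSingletonClass Y]

theorem measurable_classWeight {s : X → X → ℝ} (hs : Measurable fun q : X × X => s q.1 q.2)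
    (c : Y) : Measurable fun q : (X × Y) × X => (if q.1.2 = c then 1 else 0) * s q.1.1 q.2 := by
  refine Measurable.mul (Measurable.ite ?_ measurable_const measurable_const)
    (hs.comp (by fun_prop : Measurable fun q : (X × Y) × X => (q.1.1, q.2)))
  exact (measurable_snd.comp measurable_fst) (measurableSet_singleton c)

theorem measurable_kernelEstimate {s : X → X → ℝ} (hs : Measurable fun q : X × X => s q.1 q.2)
    {m : ℕ} (c : Y) : Measurable fun q : X × (Fin m → X × Y) => kernelEstimate s q.2 q.1 c := by
  refine Measurable.div (Finset.measurable_sum _ fun j _ => ?_)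
    (Finset.measurable_sum _ fun j _ => ?_)
  · exact (measurable_classWeight hs c).comp
      (by fun_prop : Measurable fun q : X × (Fin m → X × Y) => (q.2 j, q.1))
  · exact hs.comp (by fun_prop : Measurable fun q : X × (Fin m → X × Y) => ((q.2 j).1, q.1))

theorem measurable_posteriorEstimate {s : X → X → ℝ} (hs : Measurable fun q : X × X => s q.1 q.2)
    {n : ℕ} (i : Fin n) (c : Y) :
    Measurable fun z : Fin n → X × Y => posteriorEstimate s z i c := by
  obtain ⟨m, rfl⟩ : ∃ m, n = m + 1 := ⟨n - 1, by have := i.pos; omega⟩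
  simp_rw [posteriorEstimate_eq_kernelEstimate]
  exact (measurable_kernelEstimate hs c).comp (by fun_prop :
    Measurable fun z : Fin (m + 1) → X × Y => ((z i).1, fun j => z (i.succAbove j)))

end Estimate

/-- Independence of the left-out point from the remaining sample, in the form of Fubini's theorem.
-/
theorem integral_pi_succAbove {Z : Type*} [MeasurableSpace Z] (D : Measure Z)
    [IsProbabilityMeasure D] {m : ℕ} (i : Fin (m + 1)) {F : Z → (Fin m → Z) → ℝ}
    (hF : Integrable (Function.uncurry F) (D.prod (Measure.pi fun _ => D))) :
    ∫ z : Fin (m + 1) → Z, F (z i) (fun j => z (i.succAbove j)) ∂(Measure.pi fun _ => D) =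
      ∫ a, ∫ w, F a w ∂(Measure.pi fun _ => D) ∂D := by
  exact ((measurePreserving_piFinSuccAbove (fun _ : Fin (m + 1) => D) i).integral_comp'
    (Function.uncurry F)).trans (integral_prod _ hF)

/-! ### Posteriors and densities -/

section Posterior

variable {X Y : Type*} [MeasurableSpace X] [MeasurableSpace Y] [StandardBorelSpace Y]
  [Nonempty Y] (D : Measure (X × Y)) [IsFiniteMeasure D]

theorem posterior_nonneg (x : X) (c : Y) : 0 ≤ posterior D x c := measureReal_nonneg

theorem posterior_le_one (x : X) (c : Y) : posterior D x c ≤ 1 := measureReal_le_one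

theorem measurable_posterior (c : Y) : Measurable fun x => posterior D x c :=
  (ProbabilityTheory.Kernel.measurable_coe _ (measurableSet_singleton c)).ennreal_toReal

end Posterior

namespace IsRegularDensity

variable {d : ℕ} {Y : Type*} [Fintype Y] [MeasurableSpace Y]
  {D : Measure (EuclideanSpace ℝ (Fin d) × Y)} {g : Y → EuclideanSpace ℝ (Fin d) → ℝ}

theorem measurable (hg : IsRegularDensity D g) (c : Y) : Measurable (g c) :=
  (hg.contDiff c).continuous.measurable

theorem marginal_nonneg (hg : IsRegularDensity D g) (x : EuclideanSpace ℝ (Fin d)) :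
    0 ≤ ∑ c, g c x := Finset.sum_nonneg fun c _ => hg.nonneg c x

theorem measurable_marginal (hg : IsRegularDensity D g) : Measurable fun x => ∑ c, g c x :=
  Finset.measurable_sum _ fun c _ => hg.measurable c

theorem integrable (hg : IsRegularDensity D g) [IsFiniteMeasure D] (c : Y) :
    Integrable (g c) := by
  refine ⟨(hg.measurable c).aestronglyMeasurable,
    (hasFiniteIntegral_iff_ofReal (Filter.Eventually.of_forall (hg.nonneg c))).2 ?_⟩
  rw [← setLIntegral_univ, ← hg.density c _ MeasurableSet.univ]
  exact measure_lt_top _ _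

theorem map_fst_restrict (hg : IsRegularDensity D g) (c : Y) :
    (D.restrict (Prod.snd ⁻¹' {c})).map Prod.fst =
      volume.withDensity fun x => ENNReal.ofReal (g c x) := by
  ext A hA
  rw [Measure.map_apply measurable_fst hA, Measure.restrict_apply (measurable_fst hA),
    withDensity_apply _ hA, ← hg.density c A hA, Set.prod_eq]

variable [MeasurableSingletonClass Y]

theorem integral_classWeight [DecidableEq Y] (hg : IsRegularDensity D g) (c : Y)
    {h : EuclideanSpace ℝ (Fin d) → ℝ} (hh : Measurable h) :
    ∫ z, (if z.2 = c then 1 else 0) * h z.1 ∂D = ∫ x, h x * g c x := by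
  have hset : MeasurableSet (Prod.snd ⁻¹' {c} : Set (EuclideanSpace ℝ (Fin d) × Y)) :=
    measurable_snd (measurableSet_singleton c)
  calc _ = ∫ z, (Prod.snd ⁻¹' {c}).indicator (fun z => h z.1) z ∂D := by
        refine integral_congr_ae (Filter.Eventually.of_forall fun z => ?_)
        by_cases hz : z.2 = c <;> simp [hz]
    _ = ∫ x, h x ∂((D.restrict (Prod.snd ⁻¹' {c})).map Prod.fst) := by
        rw [integral_indicator hset, integral_map measurable_fst.aemeasurable
          hh.aestronglyMeasurable]
    _ = _ := by
        rw [hg.map_fst_restrict, integral_withDensity_eq_integral_toReal_smul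
          (hg.measurable c).ennreal_ofReal (Filter.Eventually.of_forall fun _ => by simp)]
        simp [ENNReal.toReal_ofReal (hg.nonneg c _), mul_comm]

theorem fst_eq_withDensity (hg : IsRegularDensity D g) :
    D.fst = volume.withDensity fun x => ENNReal.ofReal (∑ c, g c x) := by
  ext A hA
  have hU : Prod.fst ⁻¹' A = ⋃ c ∈ (Finset.univ : Finset Y), A ×ˢ ({c} : Set Y) := by
    ext z; simp
  rw [Measure.fst_apply hA, withDensity_apply _ hA, hU, measure_biUnion_finset]
  · simp_rw [ENNReal.ofReal_sum_of_nonneg fun c _ => hg.nonneg c _, hg.density _ A hA]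
    rw [lintegral_finsetSum _ fun c _ => (hg.measurable c).ennreal_ofReal]
  · intro c _ c' _ hcc'
    exact Set.disjoint_left.2 fun z hz hz' => hcc' (hz.2.symm.trans hz'.2)
  · exact fun c _ => hA.prod (measurableSet_singleton c)

theorem integral_fst (hg : IsRegularDensity D g) (h : EuclideanSpace ℝ (Fin d) → ℝ) :
    ∫ x, h x ∂D.fst = ∫ x, (∑ c, g c x) * h x := by
  rw [hg.fst_eq_withDensity, integral_withDensity_eq_integral_toReal_smul
    hg.measurable_marginal.ennreal_ofReal (Filter.Eventually.of_forall fun _ => by simp)]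
  simp [ENNReal.toReal_ofReal (hg.marginal_nonneg _)]

/-- Both sides have integral `D (A ×ˢ {c})` over every measurable `A`. The product form avoids
dividing where the marginal density vanishes. -/
theorem marginal_mul_posterior [Nonempty Y] [IsFiniteMeasure D] (hg : IsRegularDensity D g)
    (c : Y) : ∀ᵐ x, (∑ c', g c' x) * posterior D x c = g c x := by
  have hκ : Measurable fun x => D.condKernel x {c} :=
    ProbabilityTheory.Kernel.measurable_coe _ (measurableSet_singleton c)
  have hp := hg.measurable_marginal.ennreal_ofReal
  have key : (fun x => ENNReal.ofReal (∑ c', g c' x) * D.condKernel x {c}) =ᵐ[volume]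
      fun x => ENNReal.ofReal (g c x) := by
    refine ae_eq_of_forall_setLIntegral_eq_of_sigmaFinite (hp.mul hκ)
      (hg.measurable c).ennreal_ofReal fun A hA _ => ?_
    rw [← hg.density c A hA,
      ← Measure.setLIntegral_condKernel_eq_measure_prod hA (measurableSet_singleton c),
      hg.fst_eq_withDensity, setLIntegral_withDensity_eq_setLIntegral_mul _ hp hκ hA]
    simp
  filter_upwards [key] with x hx
  have := congrArg ENNReal.toReal hx
  rwa [ENNReal.toReal_mul, ENNReal.toReal_ofReal (hg.marginal_nonneg x),
    ENNReal.toReal_ofReal (hg.nonneg c x)] at this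

end IsRegularDensity

/-! ### Mean error of the posterior estimate -/

section MeanError

variable {d : ℕ} {K : EuclideanSpace ℝ (Fin d) → ℝ}

theorem IsSmoothingKernel.similarity_nonneg (hK : IsSmoothingKernel K) {σ : ℝ} (hσ : 0 < σ)
    (x x' : EuclideanSpace ℝ (Fin d)) : 0 ≤ similarity K σ x x' :=
  mul_nonneg (by positivity) (hK.nonneg _)

variable {Y : Type*} [Fintype Y] [MeasurableSpace Y]
  {D : Measure (EuclideanSpace ℝ (Fin d) × Y)} [IsProbabilityMeasure D]
  {g : Y → EuclideanSpace ℝ (Fin d) → ℝ}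

/-- The total smoothing bias `∑ c, |K_σ * g c - g c|` at a point. -/
def bias (K : EuclideanSpace ℝ (Fin d) → ℝ) (g : Y → EuclideanSpace ℝ (Fin d) → ℝ) (σ : ℝ)
    (x : EuclideanSpace ℝ (Fin d)) : ℝ :=
  ∑ c, |(∫ x', similarity K σ x' x * g c x') - g c x|

theorem integrable_bias_and_integral_le (hg : IsRegularDensity D g)
    (hK : IsSmoothingKernel K) {σ : ℝ} (hσ : 0 < σ) :
    Integrable (bias K g σ) ∧ ∫ x, bias K g σ x ≤
      (∫ u, ‖u‖ ^ 2 * K u) * (∑ c, ∫ x, ‖iteratedFDeriv ℝ 2 (g c) x‖) * σ ^ 2 := by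
  have h := fun c => hK.integrable_bias_and_integral_le hσ (hg.integrable c) (hg.contDiff c)
    (hg.integrable_hessian c)
  refine ⟨integrable_finsetSum _ fun c _ => (h c).1, ?_⟩
  simp only [bias]
  rw [integral_finsetSum _ fun c _ => (h c).1, Finset.mul_sum, Finset.sum_mul]
  exact Finset.sum_le_sum fun c _ => (h c).2.trans_eq (by ring)

variable [Nonempty Y] [DecidableEq Y] [MeasurableSingletonClass Y]

/-- Comparing the density with the total bias at `x` yields a bound whose two terms are both
integrable in `x`. -/
theorem marginal_mul_integral_kernelEstimate_le (hg : IsRegularDensity D g)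
    (hK : IsSmoothingKernel K) {κ : ℝ} (hκ : ∀ u, K u ≤ κ) {σ : ℝ} (hσ : 0 < σ) {m : ℕ}
    (hm : 0 < m) (c : Y) {x : EuclideanSpace ℝ (Fin d)}
    (hx : (∑ c', g c' x) * posterior D x c = g c x) :
    (∑ c', g c' x) * ∫ w : Fin m → EuclideanSpace ℝ (Fin d) × Y,
        |kernelEstimate (similarity K σ) w x c - posterior D x c| ∂(Measure.pi fun _ => D) ≤
      2 * bias K g σ x + 2 * √(2 * κ / (m * σ ^ d)) * √(∑ c', g c' x) := by
  set s := similarity K σ with hs_def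
  set p := ∑ c', g c' x with hp_def
  set B := bias K g σ x
  have hp : 0 ≤ p := hg.marginal_nonneg x
  have hm' : (0 : ℝ) < m := by exact_mod_cast hm
  have hs0 : ∀ x x', 0 ≤ s x x' := hK.similarity_nonneg hσ
  have hs := hK.measurable_similarity σ
  have hκ0 : 0 ≤ κ := (hK.nonneg 0).trans (hκ 0)
  have hsle : ∀ x x', s x x' ≤ (σ ^ d)⁻¹ * κ := fun x x' => by
    simp only [hs_def, similarity]; gcongr; exact hκ _
  have hB0 : 0 ≤ B := Finset.sum_nonneg fun _ _ => abs_nonneg _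
  have hBc : ∀ c, |(∫ x', s x' x * g c x') - g c x| ≤ B := fun c =>
    Finset.single_le_sum (f := fun c => |(∫ x', s x' x * g c x') - g c x|)
      (fun _ _ => abs_nonneg _) (Finset.mem_univ c)
  have hsx : Measurable fun x' => s x' x := hs.comp (by fun_prop : Measurable fun x' => (x', x))
  set f₁ : EuclideanSpace ℝ (Fin d) × Y → Y → ℝ := fun z c => (if z.2 = c then 1 else 0) * s z.1 x
  set f₂ : EuclideanSpace ℝ (Fin d) × Y → ℝ := fun z => s z.1 x
  have hf₁m : ∀ c, Measurable fun z => f₁ z c := fun c =>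
    (measurable_classWeight hs c).comp (by fun_prop :
      Measurable fun z : EuclideanSpace ℝ (Fin d) × Y => (z, x))
  have hf₂m : Measurable f₂ := hsx.comp measurable_fst
  have hf₁_nonneg : ∀ z c, 0 ≤ f₁ z c := fun z c => classWeight_nonneg hs0 z x c
  have hf₁₂ : ∀ z c, f₁ z c ≤ f₂ z := fun z c => classWeight_le hs0 z x c
  have hf₁L : ∀ c, MemLp (fun z => f₁ z c) 2 D := fun c =>
    MemLp.of_bound (hf₁m c).aestronglyMeasurable ((σ ^ d)⁻¹ * κ)
      (Filter.Eventually.of_forall fun z => by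
        rw [Real.norm_of_nonneg (hf₁_nonneg z c)]; exact (hf₁₂ z c).trans (hsle _ _))
  have hf₂L : MemLp f₂ 2 D := MemLp.of_bound hf₂m.aestronglyMeasurable ((σ ^ d)⁻¹ * κ)
      (Filter.Eventually.of_forall fun z => by
        rw [Real.norm_of_nonneg (hs0 _ _)]; exact hsle _ _)
  have hmean₁ : ∀ c, ∫ z, f₁ z c ∂D = ∫ x', s x' x * g c x' := fun c =>
    hg.integral_classWeight c hsx
  have hmean₂ : |(∫ z, f₂ z ∂D) - p| ≤ B := by
    have : ∫ z, f₂ z ∂D = ∑ c, ∫ x', s x' x * g c x' := by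
      simp_rw [← hmean₁]
      rw [← integral_finsetSum _ fun c _ => (hf₁L c).integrable one_le_two]
      simp [f₁, f₂]
    rw [this, hp_def, ← Finset.sum_sub_distrib]
    exact Finset.abs_sum_le_sum_abs _ _
  -- Bounding only one of the two factors by its supremum costs a single `σ⁻ᵈ` and keeps the mean,
  -- which is at most `p + B`.
  have hsq₂ : ∫ z, f₂ z ^ 2 ∂D ≤ (σ ^ d)⁻¹ * κ * (p + B) := by
    have h1 : ∫ z, f₂ z ^ 2 ∂D ≤ ∫ z, (σ ^ d)⁻¹ * κ * f₂ z ∂D := by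
      refine integral_mono hf₂L.integrable_sq ((hf₂L.integrable one_le_two).const_mul _) fun z => ?_
      change f₂ z ^ 2 ≤ _
      rw [pow_two]
      exact mul_le_mul_of_nonneg_right (hsle _ _) (hs0 _ _)
    rw [integral_const_mul] at h1
    refine h1.trans (mul_le_mul_of_nonneg_left ?_ (by positivity))
    linarith [(abs_le.1 hmean₂).2]
  have hsq₁ : ∫ z, f₁ z c ^ 2 ∂D ≤ (σ ^ d)⁻¹ * κ * (p + B) :=
    (integral_mono (hf₁L c).integrable_sq hf₂L.integrable_sq fun z =>
      pow_le_pow_left₀ (hf₁_nonneg z c) (hf₁₂ z c) 2).trans hsq₂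
  obtain ⟨hi₁, hd₁⟩ := integral_abs_average_sub_le D (hf₁L c) hm
  obtain ⟨hi₂, hd₂⟩ := integral_abs_average_sub_le D hf₂L hm
  set P : Measure (Fin m → EuclideanSpace ℝ (Fin d) × Y) := Measure.pi fun _ => D
  have hest : Measurable fun w : Fin m → EuclideanSpace ℝ (Fin d) × Y => kernelEstimate s w x c :=
    (measurable_kernelEstimate hs c).comp (by fun_prop :
      Measurable fun w : Fin m → EuclideanSpace ℝ (Fin d) × Y => (x, w))
  have hle1 : ∀ w : Fin m → EuclideanSpace ℝ (Fin d) × Y,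
      |kernelEstimate s w x c - posterior D x c| ≤ 1 := fun w =>
    abs_sub_le_of_nonneg_of_le (kernelEstimate_nonneg hs0 _ _ _) (kernelEstimate_le_one hs0 _ _ _)
      (posterior_nonneg _ _ _) (posterior_le_one _ _ _)
  have hint : Integrable (fun w => |kernelEstimate s w x c - posterior D x c|) P :=
    Integrable.of_bound (hest.sub_const _).abs.aestronglyMeasurable 1
      (Filter.Eventually.of_forall fun w => by rw [Real.norm_eq_abs, abs_abs]; exact hle1 w)
  rcases le_total p B with hpB | hBp
  -- Where the bias exceeds the density, the trivial error bound 1 suffices.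
  · have h1 : ∫ w, |kernelEstimate s w x c - posterior D x c| ∂P ≤ 1 := by
      simpa using integral_mono hint (integrable_const (1 : ℝ)) hle1
    have : 0 ≤ 2 * √(2 * κ / (m * σ ^ d)) * √p := by positivity
    linarith [mul_le_of_le_one_right hp h1]
  -- Here `p + B ≤ 2p`, which accounts for the 2 in `2 * κ` and leaves `√p`.
  · have hroot : √((σ ^ d)⁻¹ * κ * (p + B) / m) ≤ √(2 * κ / (m * σ ^ d)) * √p := by
      rw [← Real.sqrt_mul (by positivity)]
      refine Real.sqrt_le_sqrt ?_
      calc (σ ^ d)⁻¹ * κ * (p + B) / m ≤ (σ ^ d)⁻¹ * κ * (p + p) / m := by gcongr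
        _ = _ := by field_simp; ring
    have hpt : ∀ w : Fin m → EuclideanSpace ℝ (Fin d) × Y,
        p * |kernelEstimate s w x c - posterior D x c| ≤
          (|(∑ j, f₁ (w j) c) / m - ∫ z, f₁ z c ∂D| + |(∑ j, f₂ (w j)) / m - ∫ z, f₂ z ∂D|)
            + 2 * B := fun w => by
      have h := mul_abs_div_sub_le (m := m) (Finset.sum_nonneg fun j (_ : j ∈ Finset.univ) => hf₁_nonneg (w j) c)
        (Finset.sum_le_sum fun j _ => hf₁₂ (w j) c) hp hx
      have h1 := abs_sub_le ((∑ j, f₁ (w j) c) / m) (∫ z, f₁ z c ∂D) (g c x)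
      have h2 := abs_sub_le ((∑ j, f₂ (w j)) / m) (∫ z, f₂ z ∂D) p
      have h3 := hBc c
      rw [← hmean₁] at h3
      simp only [kernelEstimate]
      linarith
    have hi₁₂ := hi₁.fun_add hi₂
    have hI := integral_mono (hint.const_mul p) (hi₁₂.fun_add (integrable_const (2 * B))) hpt
    rw [integral_const_mul, integral_add hi₁₂ (integrable_const _), integral_add hi₁ hi₂] at hI
    have h1 := hd₁.trans (Real.sqrt_le_sqrt (div_le_div_of_nonneg_right hsq₁ hm'.le))
    have h2 := hd₂.trans (Real.sqrt_le_sqrt (div_le_div_of_nonneg_right hsq₂ hm'.le))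
    simp only [integral_const, probReal_univ, one_smul] at hI
    linarith

theorem measurable_abs_kernelEstimate_sub_posterior (hK : IsSmoothingKernel K) (σ : ℝ) {m : ℕ}
    (c : Y) : Measurable fun q : EuclideanSpace ℝ (Fin d) ×
        (Fin m → EuclideanSpace ℝ (Fin d) × Y) =>
      |kernelEstimate (similarity K σ) q.2 q.1 c - posterior D q.1 c| :=
  ((measurable_kernelEstimate (hK.measurable_similarity σ) c).sub
    ((measurable_posterior D c).comp measurable_fst)).abs

theorem abs_posteriorEstimate_sub_posterior_le_one (hK : IsSmoothingKernel K) {σ : ℝ} (hσ : 0 < σ)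
    {n : ℕ} (z : Fin n → EuclideanSpace ℝ (Fin d) × Y) (i : Fin n) (c : Y) :
    |posteriorEstimate (similarity K σ) z i c - posterior D (z i).1 c| ≤ 1 := by
  obtain ⟨m, rfl⟩ : ∃ m, n = m + 1 := ⟨n - 1, by have := i.pos; omega⟩
  rw [posteriorEstimate_eq_kernelEstimate]
  exact abs_sub_le_of_nonneg_of_le (kernelEstimate_nonneg (hK.similarity_nonneg hσ) _ _ _)
    (kernelEstimate_le_one (hK.similarity_nonneg hσ) _ _ _)
    (posterior_nonneg _ _ _) (posterior_le_one _ _ _)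

theorem integrable_abs_posteriorEstimate_sub (hK : IsSmoothingKernel K) {σ : ℝ} (hσ : 0 < σ)
    {n : ℕ} (i : Fin n) (c : Y) :
    Integrable (fun z : Fin n → EuclideanSpace ℝ (Fin d) × Y =>
      |posteriorEstimate (similarity K σ) z i c - posterior D (z i).1 c|)
      (Measure.pi fun _ => D) := by
  have hpost : Measurable fun z : Fin n → EuclideanSpace ℝ (Fin d) × Y => posterior D (z i).1 c :=
    (measurable_posterior D c).comp (by fun_prop)
  exact Integrable.of_bound ((measurable_posteriorEstimate (hK.measurable_similarity σ) i c).sub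
    hpost).abs.aestronglyMeasurable 1 (Filter.Eventually.of_forall fun z => by
      rw [Real.norm_eq_abs, abs_abs]
      exact abs_posteriorEstimate_sub_posterior_le_one hK hσ z i c)

theorem integral_abs_posteriorEstimate_sub_eq (hg : IsRegularDensity D g)
    (hK : IsSmoothingKernel K) {σ : ℝ} (hσ : 0 < σ) {m : ℕ} (i : Fin (m + 1)) (c : Y) :
    ∫ z : Fin (m + 1) → EuclideanSpace ℝ (Fin d) × Y,
        |posteriorEstimate (similarity K σ) z i c - posterior D (z i).1 c|
          ∂(Measure.pi fun _ => D) =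
      ∫ x, (∑ c', g c' x) * ∫ w : Fin m → EuclideanSpace ℝ (Fin d) × Y,
        |kernelEstimate (similarity K σ) w x c - posterior D x c| ∂(Measure.pi fun _ => D) := by
  have hmeas := measurable_abs_kernelEstimate_sub_posterior (D := D) hK σ (m := m) c
  have hmeas' : Measurable fun q : (EuclideanSpace ℝ (Fin d) × Y) ×
      (Fin m → EuclideanSpace ℝ (Fin d) × Y) =>
      |kernelEstimate (similarity K σ) q.2 q.1.1 c - posterior D q.1.1 c| :=
    (hmeas.comp (f := fun q : (EuclideanSpace ℝ (Fin d) × Y) ×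
      (Fin m → EuclideanSpace ℝ (Fin d) × Y) => (q.1.1, q.2))
      (measurable_fst.fst.prodMk measurable_snd) :)
  have hint : Integrable (Function.uncurry fun (a : EuclideanSpace ℝ (Fin d) × Y)
      (w : Fin m → EuclideanSpace ℝ (Fin d) × Y) =>
      |kernelEstimate (similarity K σ) w a.1 c - posterior D a.1 c|)
      (D.prod (Measure.pi fun _ => D)) :=
    Integrable.of_bound hmeas'.aestronglyMeasurable 1 (Filter.Eventually.of_forall fun q => by
      rw [Real.norm_eq_abs, Function.uncurry, abs_abs]
      exact abs_sub_le_of_nonneg_of_le (kernelEstimate_nonneg (hK.similarity_nonneg hσ) _ _ _)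
        (kernelEstimate_le_one (hK.similarity_nonneg hσ) _ _ _)
        (posterior_nonneg _ _ _) (posterior_le_one _ _ _))
  have hH : Measurable fun x => ∫ w : Fin m → EuclideanSpace ℝ (Fin d) × Y,
      |kernelEstimate (similarity K σ) w x c - posterior D x c| ∂(Measure.pi fun _ => D) :=
    hmeas.stronglyMeasurable.integral_prod_right'.measurable
  have hfst : ∀ h : EuclideanSpace ℝ (Fin d) → ℝ, Measurable h →
      ∫ x, h x ∂D.fst = ∫ a, h a.1 ∂D := fun h hh =>
    integral_map measurable_fst.aemeasurable hh.aestronglyMeasurable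
  rw [← hg.integral_fst, hfst _ hH]
  simp_rw [posteriorEstimate_eq_kernelEstimate]
  exact integral_pi_succAbove D i hint

/-- For `σ ≤ 1` the second term dominates since `σ ^ d ≤ 1`; for `σ ≥ 1` the first term is already
at least 1. -/
theorem one_div_sqrt_le_rate {C₁ C₂ : ℝ} (h₁ : 1 ≤ C₁) (h₂ : 1 ≤ C₂) {n : ℕ} (hn : 1 ≤ n)
    {σ : ℝ} (hσ : 0 < σ) (d : ℕ) : 1 / √n ≤ C₂ * σ ^ 2 + C₁ / √(n * σ ^ d) := by
  have hn' : (1 : ℝ) ≤ n := by exact_mod_cast hn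
  rcases le_total σ 1 with h | h
  · have hle : √(n * σ ^ d) ≤ √n :=
      Real.sqrt_le_sqrt (mul_le_of_le_one_right (by positivity) (pow_le_one₀ hσ.le h))
    have : 1 / √n ≤ C₁ / √(n * σ ^ d) := by gcongr
    nlinarith [sq_nonneg σ]
  · have h3 : 1 / √(n : ℝ) ≤ 1 := by
      rw [div_le_one (by positivity)]; exact Real.one_le_sqrt.2 hn'
    have h4 : 1 ≤ C₂ * σ ^ 2 := one_le_mul_of_one_le_of_one_le h₂ (one_le_pow₀ h)
    have h5 : 0 ≤ C₁ / √(n * σ ^ d) := by positivity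
    linarith

theorem exists_integral_abs_posteriorEstimate_sub_le (hg : IsRegularDensity D g)
    (hK : IsSmoothingKernel K) :
    ∃ C₁ C₂ : ℝ, 1 ≤ C₁ ∧ 1 ≤ C₂ ∧ ∀ n : ℕ, 1 ≤ n → ∀ σ : ℝ, 0 < σ → ∀ (i : Fin n) (c : Y),
      ∫ z : Fin n → EuclideanSpace ℝ (Fin d) × Y,
        |posteriorEstimate (similarity K σ) z i c - posterior D (z i).1 c|
          ∂(Measure.pi fun _ => D) ≤ C₂ * σ ^ 2 + C₁ / √(n * σ ^ d) := by
  obtain ⟨κ, hκ⟩ := hK.bounded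
  have hκ0 : 0 ≤ κ := (hK.nonneg 0).trans (hκ 0)
  set R := ∫ x, √(∑ c, g c x)
  have hR : 0 ≤ R := integral_nonneg fun _ => Real.sqrt_nonneg _
  set M := (∫ u, ‖u‖ ^ 2 * K u) * ∑ c, ∫ x, ‖iteratedFDeriv ℝ 2 (g c) x‖
  have hM : 0 ≤ M := mul_nonneg (integral_nonneg fun u => mul_nonneg (sq_nonneg _) (hK.nonneg u))
    (Finset.sum_nonneg fun c _ => integral_nonneg fun _ => norm_nonneg _)
  -- The summand 1 in each constant makes `one_div_sqrt_le_rate` applicable; `4 * κ` is `2 * κ`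
  -- doubled, to pass from `m` to `n = m + 1`.
  refine ⟨1 + 2 * √(4 * κ) * R, 1 + 2 * M, by simp; positivity, by simp; positivity, ?_⟩
  intro n hn σ hσ i c
  obtain ⟨m, rfl⟩ : ∃ m, n = m + 1 := ⟨n - 1, by omega⟩
  -- For `n = 1` no other point remains, and the trivial bound is `1 = 1 / √n`.
  rcases Nat.eq_zero_or_pos m with rfl | hm
  · refine le_trans ?_ (one_div_sqrt_le_rate (by simp; positivity) (by simp; positivity)
      hn hσ d)
    simpa using integral_mono (integrable_abs_posteriorEstimate_sub (D := D) hK hσ i c)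
      (integrable_const (1 : ℝ)) fun z => abs_posteriorEstimate_sub_posterior_le_one hK hσ z i c
  obtain ⟨hbi, hb⟩ := integrable_bias_and_integral_le hg hK hσ
  have hm' : (1 : ℝ) ≤ m := by exact_mod_cast hm
  set a := √(2 * κ / (m * σ ^ d))
  have ha : a ≤ √(4 * κ) / √((m + 1 : ℕ) * σ ^ d) := by
    rw [← Real.sqrt_div (by positivity)]
    refine Real.sqrt_le_sqrt ?_
    rw [div_le_div_iff₀ (by positivity) (by positivity)]
    have : 0 ≤ κ * σ ^ d := by positivity
    push_cast
    nlinarith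
  rw [integral_abs_posteriorEstimate_sub_eq hg hK hσ]
  calc _ ≤ ∫ x, (2 * bias K g σ x + 2 * a * √(∑ c', g c' x)) := by
        refine integral_mono_of_nonneg (Filter.Eventually.of_forall fun x => ?_)
          ((hbi.const_mul 2).add (hg.integrable_sqrt.const_mul (2 * a))) ?_
        · exact mul_nonneg (hg.marginal_nonneg x) (integral_nonneg fun _ => abs_nonneg _)
        · filter_upwards [hg.marginal_mul_posterior c] with x hx
          exact marginal_mul_integral_kernelEstimate_le hg hK hκ hσ hm c hx
    _ = 2 * (∫ x, bias K g σ x) + 2 * a * R := by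
        rw [integral_add (hbi.const_mul 2) (hg.integrable_sqrt.const_mul (2 * a)),
          integral_const_mul, integral_const_mul]
    _ ≤ 2 * (M * σ ^ 2) + 2 * (√(4 * κ) / √((m + 1 : ℕ) * σ ^ d)) * R := by gcongr
    _ ≤ _ := by
        have h1 : 0 ≤ σ ^ 2 := sq_nonneg σ
        have h2 : 0 ≤ 1 / √((m + 1 : ℕ) * σ ^ d) := by positivity
        have h3 : (1 + 2 * √(4 * κ) * R) / √((m + 1 : ℕ) * σ ^ d) =
          1 / √((m + 1 : ℕ) * σ ^ d) + 2 * (√(4 * κ) / √((m + 1 : ℕ) * σ ^ d)) * R := by ring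
        rw [h3]
        linarith

end MeanError

/-! ### From posteriors to the Bayes error -/

theorem abs_iSup_sub_iSup_le_sum {Y : Type*} [Fintype Y] [Nonempty Y] (u v : Y → ℝ) :
    |(⨆ c, u c) - ⨆ c, v c| ≤ ∑ c, |u c - v c| := by
  have key : ∀ u v : Y → ℝ, (⨆ c, u c) ≤ (⨆ c, v c) + ∑ c, |u c - v c| := fun u v => by
    refine ciSup_le fun c => ?_
    have h1 := le_ciSup (Finite.bddAbove_range v) c
    have h2 := Finset.single_le_sum (f := fun c => |u c - v c|) (fun _ _ => abs_nonneg _)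
      (Finset.mem_univ c)
    have h3 := le_abs_self (u c - v c)
    linarith
  rw [abs_le]
  have h1 := key u v
  have h2 := key v u
  simp_rw [abs_sub_comm (v _)] at h2
  constructor <;> linarith

section BayesErrorEstimate

variable {X Y : Type*} [MeasurableSpace X] [Fintype Y] [MeasurableSpace Y]
  [MeasurableSingletonClass Y] [Nonempty Y] (D : Measure (X × Y)) [IsProbabilityMeasure D]

theorem measurable_iSup_posterior : Measurable fun x => ⨆ c, posterior D x c :=
  Measurable.iSup fun c => measurable_posterior D c

theorem iSup_posterior_nonneg (x : X) : 0 ≤ ⨆ c, posterior D x c :=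
  Real.iSup_nonneg fun c => posterior_nonneg D x c

theorem iSup_posterior_le_one (x : X) : ⨆ c, posterior D x c ≤ 1 :=
  ciSup_le fun c => posterior_le_one D x c

theorem memLp_iSup_posterior : MemLp (fun z : X × Y => ⨆ c, posterior D z.1 c) 2 D :=
  MemLp.of_bound ((measurable_iSup_posterior D).comp measurable_fst).aestronglyMeasurable 1
    (Filter.Eventually.of_forall fun z => by
      rw [Real.norm_of_nonneg (iSup_posterior_nonneg D _)]; exact iSup_posterior_le_one D _)

theorem bayesError_eq : bayesError D = 1 - ∫ z : X × Y, ⨆ c, posterior D z.1 c ∂D := by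
  have hm := measurable_iSup_posterior D
  rw [bayesError, Measure.fst, integral_map measurable_fst.aemeasurable
    (hm.const_sub 1).aestronglyMeasurable, integral_sub (integrable_const _)
    ((memLp_iSup_posterior D).integrable one_le_two)]
  simp

/-- The average of the true maxima over the sample points is inserted, separating the error in the
posteriors from the sampling error of an i.i.d. average. -/
theorem abs_bayesErrorEstimate_sub_le [DecidableEq Y] (s : X → X → ℝ) {n : ℕ} (hn : 1 ≤ n)
    (z : Fin n → X × Y) :
    |bayesErrorEstimate s z - bayesError D| ≤
      (1 / n) * ∑ i, ∑ c, |posteriorEstimate s z i c - posterior D (z i).1 c|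
        + |(∑ i, ⨆ c, posterior D (z i).1 c) / n - ∫ z : X × Y, ⨆ c, posterior D z.1 c ∂D| := by
  have hn' : (0 : ℝ) < n := by exact_mod_cast hn
  have heq : bayesErrorEstimate s z - bayesError D =
      -((1 / n) * ∑ i, ((⨆ c, posteriorEstimate s z i c) - ⨆ c, posterior D (z i).1 c))
        - ((∑ i, ⨆ c, posterior D (z i).1 c) / n - ∫ z : X × Y, ⨆ c, posterior D z.1 c ∂D) := by
    rw [bayesError_eq, bayesErrorEstimate, Finset.sum_sub_distrib]; ring
  rw [heq]
  refine (abs_sub _ _).trans (add_le_add_left ?_ _)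
  rw [abs_neg, abs_mul, abs_of_pos (by positivity)]
  gcongr
  exact (Finset.abs_sum_le_sum_abs _ _).trans
    (Finset.sum_le_sum fun i _ => abs_iSup_sub_iSup_le_sum _ _)

end BayesErrorEstimate

end BayesError

end

theorem mainTheorem1 {d : ℕ} {Y : Type*} [Fintype Y] [Nonempty Y] [DecidableEq Y]
    [MeasurableSpace Y] [MeasurableSingletonClass Y]
    (D : Measure (EuclideanSpace ℝ (Fin d) × Y)) [IsProbabilityMeasure D]
    (g : Y → EuclideanSpace ℝ (Fin d) → ℝ) (hg : BayesError.IsRegularDensity D g)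
    (K : EuclideanSpace ℝ (Fin d) → ℝ) (hK : BayesError.IsSmoothingKernel K) :
    ∃ C₁ C₂ : ℝ, 0 < C₁ ∧ 0 < C₂ ∧
      ∀ n : ℕ, 1 ≤ n → ∀ σ : ℝ, 0 < σ →
        (∀ (i : Fin n) (c : Y),
          Integrable (fun z : Fin n → EuclideanSpace ℝ (Fin d) × Y =>
            |BayesError.posteriorEstimate (BayesError.similarity K σ) z i c
              - BayesError.posterior D (z i).1 c|) (Measure.pi fun _ => D) ∧
          ∫ z : Fin n → EuclideanSpace ℝ (Fin d) × Y,
            |BayesError.posteriorEstimate (BayesError.similarity K σ) z i c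
              - BayesError.posterior D (z i).1 c| ∂(Measure.pi fun _ => D)
            ≤ C₂ * σ ^ 2 + C₁ / √(n * σ ^ d)) ∧
        (Integrable (fun z : Fin n → EuclideanSpace ℝ (Fin d) × Y =>
            |BayesError.bayesErrorEstimate (BayesError.similarity K σ) z
              - BayesError.bayesError D|) (Measure.pi fun _ => D) ∧
          ∫ z : Fin n → EuclideanSpace ℝ (Fin d) × Y,
            |BayesError.bayesErrorEstimate (BayesError.similarity K σ) z
              - BayesError.bayesError D| ∂(Measure.pi fun _ => D)
            ≤ 2 * C₂ * Fintype.card Y * σ ^ 2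
              + 2 * C₁ * Fintype.card Y / √(n * σ ^ d)) := by
  obtain ⟨C₁, C₂, h₁, h₂, hC⟩ :=
    BayesError.exists_integral_abs_posteriorEstimate_sub_le (D := D) hg hK
  refine ⟨C₁, C₂, by linarith, by linarith, fun n hn σ hσ => ?_⟩
  have hn' : (0 : ℝ) < n := by exact_mod_cast hn
  have hint := fun (i : Fin n) (c : Y) =>
    BayesError.integrable_abs_posteriorEstimate_sub (D := D) hK hσ i c
  obtain ⟨hdi, hd⟩ :=
    BayesError.integral_abs_average_sub_le D (BayesError.memLp_iSup_posterior D) hn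
  have hsum := (integrable_finsetSum Finset.univ fun (i : Fin n) _ =>
    integrable_finsetSum Finset.univ fun (c : Y) _ => hint i c).const_mul (1 / (n : ℝ))
  have hle := BayesError.abs_bayesErrorEstimate_sub_le D (BayesError.similarity K σ) hn
  have hmeas : Measurable fun z : Fin n → EuclideanSpace ℝ (Fin d) × Y =>
      |BayesError.bayesErrorEstimate (BayesError.similarity K σ) z - BayesError.bayesError D| := by
    refine ((Measurable.const_sub (Measurable.const_mul
      (Finset.measurable_sum _ fun i _ => ?_) _) _).sub_const _).abs
    exact Measurable.iSup fun c => 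
      BayesError.measurable_posteriorEstimate (hK.measurable_similarity σ) i c
  have hbint : Integrable (fun z : Fin n → EuclideanSpace ℝ (Fin d) × Y =>
      |BayesError.bayesErrorEstimate (BayesError.similarity K σ) z - BayesError.bayesError D|)
      (Measure.pi fun _ => D) :=
    (hsum.add hdi).mono' hmeas.aestronglyMeasurable (Filter.Eventually.of_forall fun z => by
      rw [Real.norm_eq_abs, abs_abs]; exact hle z)
  refine ⟨fun i c => ⟨hint i c, hC n hn σ hσ i c⟩, hbint, ?_⟩
  set b := C₂ * σ ^ 2 + C₁ / √(n * σ ^ d) with hb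
  have hbpos : 0 ≤ b := by positivity
  have hcard : (1 : ℝ) ≤ Fintype.card Y := by exact_mod_cast Fintype.card_pos
  -- The maximal posterior lies in `[0, 1]`, so its second moment is at most 1 and the sampling
  -- error at most `1 / √n`.
  have hdev : √((∫ z : EuclideanSpace ℝ (Fin d) × Y,
      (⨆ c, BayesError.posterior D z.1 c) ^ 2 ∂D) / n) ≤ b := by
    refine le_trans ?_ (BayesError.one_div_sqrt_le_rate h₁ h₂ hn hσ d)
    rw [← Real.sqrt_one, ← Real.sqrt_div zero_le_one]
    gcongr
    simpa using integral_mono (BayesError.memLp_iSup_posterior D).integrable_sq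
      (integrable_const (1 : ℝ)) fun z => pow_le_one₀ (BayesError.iSup_posterior_nonneg D z.1)
        (BayesError.iSup_posterior_le_one D z.1)
  calc _ ≤ _ := integral_mono hbint (hsum.add hdi) hle
    _ = (1 / n) * ∑ i : Fin n, ∑ c : Y, (∫ z : Fin n → EuclideanSpace ℝ (Fin d) × Y,
            |BayesError.posteriorEstimate (BayesError.similarity K σ) z i c
              - BayesError.posterior D (z i).1 c| ∂(Measure.pi fun _ => D))
          + ∫ z : Fin n → EuclideanSpace ℝ (Fin d) × Y,
            |(∑ i, ⨆ c, BayesError.posterior D (z i).1 c) / n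
              - ∫ z : EuclideanSpace ℝ (Fin d) × Y, ⨆ c, BayesError.posterior D z.1 c ∂D|
              ∂(Measure.pi fun _ => D) := by
        simp only [Pi.add_apply]
        rw [integral_add hsum hdi, integral_const_mul,
          integral_finsetSum _ fun i _ => integrable_finsetSum _ fun c _ => hint i c]
        simp_rw [integral_finsetSum Finset.univ fun c _ => hint _ c]
    _ ≤ (1 / n) * ∑ i : Fin n, ∑ c : Y, b + b := by
        gcongr with i _ c
        · exact hC n hn σ hσ i c
        · exact hd.trans hdev
    _ = Fintype.card Y * b + b := by
        simp only [Finset.sum_const, Finset.card_univ, Fintype.card_fin, nsmul_eq_mul]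
        field_simp
    -- The lone `b` from the sampling error is absorbed because there is at least one label; hence
    -- the factor 2.
    _ ≤ 2 * (Fintype.card Y * b) := by nlinarith
    _ = _ := by rw [hb]; ring
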